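/- Let $c_{00}$ be the space of finitely nonzero real sequences with $\|u\|_1=\sum_j|u(j)|$, and let $\Phi:c_{00}\to\mathbb R$ be a quasilinear map, i.e. $\Phi(\alpha u)=\alpha\Phi(u)$ for all $\alpha\in\mathbb R$, $u\in c_{00}$, and there is a constant $\delta$ with $|\Phi(u)+\Phi(v)-\Phi(u+v)|\le\delta(\|u\|_1+\|v\|_1)$ for all $u,v\in c_{00}$. Let $Y=\mathbb R\oplus_\Phi\ell_1$ be the completion of $\mathbb R\oplus c_{00}$ under the quasinorm $\|(\alpha,u)\|_\Phi=|\alpha-\Phi(u)|+\|u\|_1$, with its topology $\tau$, let $e_0=(1,0)\in Y$, and let $\pi:Y\to\ell_1$ be the quotient map, i.e. the continuous extension of $(\alpha,u)\mapsto u$. Suppose that at least one of the following conditions holds. 1. $Y$ contains no basic sequence. (A basic sequence is a sequence $(x_n)$ such that every element of its closed linear span has a unique expansion $\sum_n a_nx_n$.) 2. Every closed infinite-dimensional subspace of $Y$ contains $e_0$. 3. $\pi$ is strictly singular: there is no closed infinite-dimensional subspace of $Y$ on which $\pi$ is an isomorphism onto its image. 4. $Y$ is topologically minimal: there is no Hausdorff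 vector topology on $Y$ strictly weaker than $\tau$. 5. There is no infinite-dimensional subspace $F$ of $c_{00}$ such that, for some constant $K$, $|\Phi(u)|\le K\|u\|_1$ for all $u\in F$. 6. Every bounded linear operator $T:\ell_1\to Y$ is compact. 7. Every bounded linear operator $T:Y\to Y$ is of the form $T=\lambda I+S$ with $\lambda\in\mathbb R$ and $S$ compact. Then $\tau$ is not the supremum of two (not necessarily Hausdorff) vector topologies $\tau_1,\tau_2$ on $Y$ such that $(Y,\tau_1)$ is nearly convex (its Hausdorff quotient has a separating dual) and $(Y,\tau_2)$ has trivial dual (its only continuous linear functional is $0$). -/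

import Mathlib

open Filter Topology

noncomputable section

/-- The norm `‖u‖₁ = ∑ |u j|` on the space `c₀₀ = ℕ →₀ ℝ` of finitely nonzero real sequences. -/
def l1Norm (u : ℕ →₀ ℝ) : ℝ := ∑ j ∈ u.support, |u j|

/-- The Banach space `ℓ₁` of absolutely summable real sequences. -/
abbrev EllOne : Type := lp (fun _ : ℕ => ℝ) 1

/-- The inclusion of `c₀₀` into `ℓ₁`. -/
def toEllOne : (ℕ →₀ ℝ) →ₗ[ℝ] EllOne where
  toFun u := ⟨fun j => u j, (memℓp_zero u.hasFiniteSupport).of_exponent_ge zero_le⟩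
  map_add' _ _ := rfl
  map_smul' _ _ := rfl

theorem norm_toEllOne (u : ℕ →₀ ℝ) : ‖toEllOne u‖ = l1Norm u := by
  rw [lp.norm_eq_tsum_rpow (by norm_num)]
  simp only [ENNReal.toReal_one, Real.rpow_one, div_one, l1Norm]
  refine (tsum_eq_sum (s := u.support) ?_)
  intro j hj
  have h : u j = 0 := by simpa using hj
  change |u j| = 0
  rw [h, abs_zero]

theorem l1Norm_nonneg (u : ℕ →₀ ℝ) : 0 ≤ l1Norm u := by
  rw [← norm_toEllOne]; exact norm_nonneg _

theorem l1Norm_add_le (u v : ℕ →₀ ℝ) : l1Norm (u + v) ≤ l1Norm u + l1Norm v := by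
  simp only [← norm_toEllOne, map_add]; exact norm_add_le _ _

theorem l1Norm_smul (a : ℝ) (u : ℕ →₀ ℝ) : l1Norm (a • u) = |a| * l1Norm u := by
  simp only [← norm_toEllOne, map_smul]; exact norm_smul _ _

/-- Quasilinear maps `Φ : c₀₀ → ℝ`: homogeneous maps with
`|Φ u + Φ v - Φ (u + v)| ≤ δ (‖u‖₁ + ‖v‖₁)` for a constant `δ`. -/
structure QuasilinearMap where
  toFun : (ℕ →₀ ℝ) → ℝ
  map_smul : ∀ (a : ℝ) (u : ℕ →₀ ℝ), toFun (a • u) = a * toFun u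
  quasi_additive : ∃ δ : ℝ, ∀ u v : ℕ →₀ ℝ,
    |toFun u + toFun v - toFun (u + v)| ≤ δ * (l1Norm u + l1Norm v)

instance : CoeFun QuasilinearMap (fun _ => (ℕ →₀ ℝ) → ℝ) := ⟨QuasilinearMap.toFun⟩

/-- The vector space `ℝ ⊕ c₀₀`, to be topologized by the quasinorm that `Φ` defines. -/
def PreTwistedSum (_Φ : QuasilinearMap) : Type := ℝ × (ℕ →₀ ℝ)

namespace PreTwistedSum

variable (Φ : QuasilinearMap)

instance : AddCommGroup (PreTwistedSum Φ) := inferInstanceAs (AddCommGroup (ℝ × (ℕ →₀ ℝ)))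

instance : Module ℝ (PreTwistedSum Φ) := inferInstanceAs (Module ℝ (ℝ × (ℕ →₀ ℝ)))

/-- The pair `(α, u)`. -/
def mk (α : ℝ) (u : ℕ →₀ ℝ) : PreTwistedSum Φ := (α, u)

/-- The quasinorm `‖(α, u)‖ = |α - Φ u| + ‖u‖₁`. -/
def quasinorm (x : PreTwistedSum Φ) : ℝ := |x.1 - Φ x.2| + l1Norm x.2

theorem quasinorm_nonneg (x : PreTwistedSum Φ) : 0 ≤ quasinorm Φ x :=
  add_nonneg (abs_nonneg _) (l1Norm_nonneg _)

theorem quasinorm_smul (a : ℝ) (x : PreTwistedSum Φ) :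
    quasinorm Φ (a • x) = |a| * quasinorm Φ x := by
  change |a * x.1 - Φ (a • x.2)| + l1Norm (a • x.2) = _
  rw [Φ.map_smul, l1Norm_smul, ← mul_sub, abs_mul, ← mul_add]
  rfl

theorem quasinorm_zero : quasinorm Φ 0 = 0 := by
  have h := quasinorm_smul Φ 0 0
  simpa using h

theorem quasinorm_add_le : ∃ C : ℝ, 0 < C ∧ ∀ x y : PreTwistedSum Φ,
    quasinorm Φ (x + y) ≤ C * (quasinorm Φ x + quasinorm Φ y) := by
  obtain ⟨δ, hδ⟩ := Φ.quasi_additive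
  refine ⟨1 + |δ|, by positivity, fun x y => ?_⟩
  change |x.1 + y.1 - Φ (x.2 + y.2)| + l1Norm (x.2 + y.2) ≤
    (1 + |δ|) * (|x.1 - Φ x.2| + l1Norm x.2 + (|y.1 - Φ y.2| + l1Norm y.2))
  have h0 := hδ x.2 y.2
  have hx := l1Norm_nonneg x.2
  have hy := l1Norm_nonneg y.2
  have hxy := l1Norm_add_le x.2 y.2
  have h1 : δ * (l1Norm x.2 + l1Norm y.2) ≤ |δ| * (l1Norm x.2 + l1Norm y.2) :=
    mul_le_mul_of_nonneg_right (le_abs_self δ) (add_nonneg hx hy)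
  have h2 : |x.1 + y.1 - Φ (x.2 + y.2)| ≤ |x.1 - Φ x.2| + |y.1 - Φ y.2| +
      |Φ x.2 + Φ y.2 - Φ (x.2 + y.2)| := by
    have e : x.1 + y.1 - Φ (x.2 + y.2) = (x.1 - Φ x.2) + (y.1 - Φ y.2) +
      (Φ x.2 + Φ y.2 - Φ (x.2 + y.2)) := by ring
    rw [e]
    exact (abs_add_le _ _).trans (add_le_add (abs_add_le _ _) le_rfl)
  have h3 : 0 ≤ |δ| * (|x.1 - Φ x.2| + |y.1 - Φ y.2|) := by positivity
  nlinarith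

/-- The vector topology on `ℝ ⊕ c₀₀` for which the quasinorm balls `{x | ‖x‖ < ε}` form a base of
neighbourhoods of `0`. -/
def basis : ModuleFilterBasis ℝ (PreTwistedSum Φ) where
  toAddGroupFilterBasis := addGroupFilterBasisOfComm
    {U | ∃ ε : ℝ, 0 < ε ∧ U = {x | quasinorm Φ x < ε}}
    ⟨_, 1, one_pos, rfl⟩
    (by
      rintro _ _ ⟨ε, hε, rfl⟩ ⟨ε', hε', rfl⟩
      refine ⟨_, ⟨min ε ε', lt_min hε hε', rfl⟩, fun x hx => ?_⟩
      simp only [Set.mem_ofPred_eq, lt_min_iff] at hx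
      exact hx)
    (by
      rintro _ ⟨ε, hε, rfl⟩
      simpa only [Set.mem_ofPred_eq, quasinorm_zero] using hε)
    (by
      rintro _ ⟨ε, hε, rfl⟩
      obtain ⟨C, hC, h⟩ := quasinorm_add_le Φ
      refine ⟨_, ⟨ε / (2 * C), by positivity, rfl⟩, ?_⟩
      rintro _ ⟨x, hx, y, hy, rfl⟩
      simp only [Set.mem_ofPred_eq] at hx hy ⊢
      calc quasinorm Φ (x + y) ≤ C * (quasinorm Φ x + quasinorm Φ y) := h x y
        _ < C * (ε / (2 * C) + ε / (2 * C)) := by gcongr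
        _ = ε := by field_simp; ring)
    (by
      rintro _ ⟨ε, hε, rfl⟩
      refine ⟨_, ⟨ε, hε, rfl⟩, fun x hx => ?_⟩
      have h := quasinorm_smul Φ (-1) x
      simp only [neg_smul, one_smul, abs_neg, abs_one, one_mul] at h
      simpa only [Set.mem_preimage, Set.mem_ofPred_eq, h] using hx)
  smul' := by
    rintro _ ⟨ε, hε, rfl⟩
    refine ⟨Metric.ball 0 1, Metric.ball_mem_nhds _ one_pos, _, ⟨ε, hε, rfl⟩, ?_⟩
    rintro _ ⟨a, ha, x, hx, rfl⟩
    simp only [Metric.mem_ball, dist_zero_right, Real.norm_eq_abs] at ha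
    simp only [Set.mem_ofPred_eq] at hx
    change quasinorm Φ (a • x) < ε
    rw [quasinorm_smul]
    exact (mul_le_of_le_one_left (quasinorm_nonneg Φ x) ha.le).trans_lt hx
  smul_left' := by
    rintro a _ ⟨ε, hε, rfl⟩
    refine ⟨_, ⟨ε / (|a| + 1), by positivity, rfl⟩, fun x hx => ?_⟩
    simp only [Set.mem_ofPred_eq] at hx
    simp only [Set.mem_preimage, Set.mem_ofPred_eq]
    rw [quasinorm_smul]
    rw [lt_div_iff₀ (by positivity)] at hx
    nlinarith [quasinorm_nonneg Φ x]
  smul_right' := by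
    rintro x _ ⟨ε, hε, rfl⟩
    have h : Tendsto (fun a : ℝ => |a| * quasinorm Φ x) (𝓝 0) (𝓝 0) := by
      have : Continuous fun a : ℝ => |a| * quasinorm Φ x := by fun_prop
      simpa using this.tendsto 0
    filter_upwards [h.eventually_lt_const hε] with a ha
    simpa only [Set.mem_ofPred_eq, quasinorm_smul] using ha

/-- The translation-invariant uniform structure of that vector topology. -/
instance : UniformSpace (PreTwistedSum Φ) :=
  @IsTopologicalAddGroup.rightUniformSpace _ _ (basis Φ).topology
    (basis Φ).toAddGroupFilterBasis.isTopologicalAddGroup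

theorem topology_eq :
    (inferInstance : TopologicalSpace (PreTwistedSum Φ)) = (basis Φ).topology := rfl

instance : IsUniformAddGroup (PreTwistedSum Φ) :=
  @isUniformAddGroup_of_addCommGroup _ _ (basis Φ).topology
    (basis Φ).toAddGroupFilterBasis.isTopologicalAddGroup

instance : ContinuousSMul ℝ (PreTwistedSum Φ) := (basis Φ).continuousSMul

theorem nhds_zero_hasBasis :
    (𝓝 (0 : PreTwistedSum Φ)).HasBasis (fun ε : ℝ => 0 < ε) fun ε => {x | quasinorm Φ x < ε} := by
  refine ⟨fun U => ?_⟩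
  refine (basis Φ).toAddGroupFilterBasis.nhds_zero_hasBasis.mem_iff.trans ?_
  constructor
  · rintro ⟨_, ⟨ε, hε, rfl⟩, h⟩
    exact ⟨ε, hε, h⟩
  · rintro ⟨ε, hε, h⟩
    exact ⟨_, ⟨ε, hε, rfl⟩, h⟩

instance : UniformContinuousConstSMul ℝ (PreTwistedSum Φ) :=
  uniformContinuousConstSMul_of_continuousConstSMul _ _

/-- The map `(α, u) ↦ u` from `ℝ ⊕ c₀₀` to `ℓ₁`. -/
def toL1 : PreTwistedSum Φ →ₗ[ℝ] EllOne :=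
  toEllOne.comp (LinearMap.snd ℝ ℝ (ℕ →₀ ℝ))

theorem continuous_toL1 : Continuous (toL1 Φ) := by
  refine continuous_of_continuousAt_zero (toL1 Φ).toAddMonoidHom ?_
  change Tendsto (toL1 Φ) (𝓝 0) (𝓝 (toL1 Φ 0))
  rw [map_zero, (nhds_zero_hasBasis Φ).tendsto_iff Metric.nhds_basis_ball]
  refine fun ε hε => ⟨ε, hε, fun x hx => ?_⟩
  rw [mem_ball_zero_iff]
  change ‖toEllOne x.2‖ < ε
  rw [norm_toEllOne]
  exact (le_add_of_nonneg_left (abs_nonneg _)).trans_lt hx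

theorem uniformContinuous_toL1 : UniformContinuous (toL1 Φ) :=
  uniformContinuous_addMonoidHom_of_continuous (f := toL1 Φ) (continuous_toL1 Φ)

end PreTwistedSum

/-- The twisted sum `Y = ℝ ⊕_Φ ℓ₁`: the completion of `ℝ ⊕ c₀₀` for the quasinorm
`‖(α, u)‖ = |α - Φ u| + ‖u‖₁`. -/
abbrev TwistedSum (Φ : QuasilinearMap) : Type := UniformSpace.Completion (PreTwistedSum Φ)

namespace TwistedSum

variable (Φ : QuasilinearMap)

/-- The topology `τ` of `Y`, named so that it cannot be confused with other topologies on `Y`. -/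
abbrev topology : TopologicalSpace (TwistedSum Φ) := inferInstance

/-- The vector `e₀ = (1, 0)` of `Y`. -/
def e₀ : TwistedSum Φ := (PreTwistedSum.mk Φ 1 0 : TwistedSum Φ)

/-- The quotient map `π : Y → ℓ₁`, the continuous extension of `(α, u) ↦ u`. -/
def quotientMap : TwistedSum Φ →L[ℝ] EllOne where
  toFun := UniformSpace.Completion.extension (PreTwistedSum.toL1 Φ)
  map_add' y z := by
    have hc := UniformSpace.Completion.continuous_extension (f := PreTwistedSum.toL1 Φ)
    refine UniformSpace.Completion.induction_on₂ y z
      (isClosed_eq (hc.comp continuous_add)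
        ((hc.comp continuous_fst).add (hc.comp continuous_snd))) fun x x' => ?_
    rw [← UniformSpace.Completion.coe_add]
    simp only [UniformSpace.Completion.extension_coe (PreTwistedSum.uniformContinuous_toL1 Φ),
      map_add]
  map_smul' a y := by
    have hc := UniformSpace.Completion.continuous_extension (f := PreTwistedSum.toL1 Φ)
    refine UniformSpace.Completion.induction_on y
      (isClosed_eq (hc.comp (continuous_const_smul a)) (hc.const_smul a)) fun x => ?_
    rw [← UniformSpace.Completion.coe_smul]
    simp only [UniformSpace.Completion.extension_coe (PreTwistedSum.uniformContinuous_toL1 Φ),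
      map_smul, RingHom.id_apply]
  cont := UniformSpace.Completion.continuous_extension

theorem quotientMap_coe (x : PreTwistedSum Φ) :
    quotientMap Φ (x : TwistedSum Φ) = PreTwistedSum.toL1 Φ x :=
  UniformSpace.Completion.extension_coe (PreTwistedSum.uniformContinuous_toL1 Φ) x

end TwistedSum

section General

variable (E : Type*) [AddCommGroup E] [Module ℝ E]

/-- A (not necessarily Hausdorff) vector topology: addition and scalar multiplication are
continuous. -/
structure IsVectorTopology (t : TopologicalSpace E) : Prop where
  isTopologicalAddGroup : IsTopologicalAddGroup E
  continuousSMul : ContinuousSMul ℝ E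

/-- `(E, t)` is nearly convex: its Hausdorff quotient has a separating dual. -/
def NearlyConvex (t : TopologicalSpace E) (h : IsVectorTopology E t) : Prop :=
  haveI := h.isTopologicalAddGroup
  haveI := h.continuousSMul
  SeparatingDual ℝ (SeparationQuotient E)

/-- `(E, t)` has trivial dual: the only continuous linear functional is `0`. -/
def HasTrivialDual (t : TopologicalSpace E) : Prop :=
  ∀ f : StrongDual ℝ E, f = 0

/-- `(E, t)` is topologically minimal: there is no strictly weaker Hausdorff vector topology. -/
def IsTopologicallyMinimal (t : TopologicalSpace E) : Prop :=
  ¬ ∃ s : TopologicalSpace E, IsVectorTopology E s ∧ @T2Space E s ∧ t < s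

variable [TopologicalSpace E]

/-- A basic sequence: a sequence `x` such that every element of its closed linear span has a unique
expansion `∑ aₙ xₙ` (a limit of partial sums). -/
def IsBasicSequence (x : ℕ → E) : Prop :=
  ∀ y ∈ closure (Submodule.span ℝ (Set.range x) : Set E), ∃! a : ℕ → ℝ,
    Tendsto (fun n => ∑ i ∈ Finset.range n, a i • x i) atTop (𝓝 y)

end General

/-- A strictly singular operator: its restriction to a closed infinite-dimensional subspace is never
an isomorphism onto the image. -/
def IsStrictlySingular {E F : Type*} [AddCommGroup E] [Module ℝ E] [TopologicalSpace E]
    [AddCommGroup F] [Module ℝ F] [TopologicalSpace F] (T : E →L[ℝ] F) : Prop :=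
  ¬ ∃ M : Submodule ℝ E, IsClosed (M : Set E) ∧ ¬ FiniteDimensional ℝ M ∧
    IsEmbedding fun m : M => T m

namespace TwistedSum

variable (Φ : QuasilinearMap)

/-- `Y` contains no basic sequence. -/
def NoBasicSequence : Prop := ¬ ∃ x : ℕ → TwistedSum Φ, IsBasicSequence (TwistedSum Φ) x

/-- Every closed infinite-dimensional subspace of `Y` contains `e₀`. -/
def ClosedSubspacesContain : Prop :=
  ∀ M : Submodule ℝ (TwistedSum Φ), IsClosed (M : Set (TwistedSum Φ)) →
    ¬ FiniteDimensional ℝ M → e₀ Φ ∈ M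

/-- `Φ` is unbounded on the unit sphere of every infinite-dimensional subspace of `c₀₀`. -/
def NowhereBounded : Prop :=
  ¬ ∃ F : Submodule ℝ (ℕ →₀ ℝ), ¬ FiniteDimensional ℝ F ∧
    ∃ K : ℝ, ∀ u ∈ F, |Φ u| ≤ K * l1Norm u

/-- Every bounded operator `ℓ₁ → Y` is compact. -/
def OperatorsFromEllOneCompact : Prop :=
  ∀ T : EllOne →L[ℝ] TwistedSum Φ, IsCompactOperator T

/-- Every bounded operator on `Y` is of the form `lam • I + S` with `S` compact. -/
def OperatorsScalarPlusCompact : Prop :=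
  ∀ T : TwistedSum Φ →L[ℝ] TwistedSum Φ, ∃ (lam : ℝ) (S : TwistedSum Φ →L[ℝ] TwistedSum Φ),
    IsCompactOperator S ∧ ∀ y, T y = lam • y + S y

end TwistedSum

end

/-! Everything reduces to one property, `BoundedOnBlock`. If `Φ` is bounded on the span of a
normalized block sequence `v`, then the unit vectors of `ℓ₁` can be sent to `(0, v n)`, which gives
a copy of `ℓ₁` in `Y`, complemented through `π`. Such a copy violates each of the seven conditions
(`not_condition_of_boundedOnBlock`).

Suppose `τ` is the supremum of `τ₁` and `τ₂`. If `τ₁` separates `e₀` from `0`, near convexity gives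
a continuous functional that does not vanish at `e₀`; then `Φ` is at bounded distance from a linear
functional, and is bounded on blocks in its kernel. Otherwise, `τ` being Hausdorff, some
`τ₂`-neighbourhood of `0` misses `e₀`. Since `τ₂` has trivial dual, its neighbourhoods contain
normalized vectors supported arbitrarily far out. A rapidly chosen block sequence of these spans a
space on which `Φ` is again close to a linear functional, for otherwise `e₀` would lie in that
neighbourhood (`boundedOnBlock_of_trivial_dual`). -/

/-! ### Extension from dense images, and spaces with trivial dual. -/

theorem exists_extension_of_denseRange {X E Z : Type*} [AddCommGroup X] [Module ℝ X]
    [AddCommGroup E] [Module ℝ E] [TopologicalSpace E] [IsTopologicalAddGroup E]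
    [ContinuousConstSMul ℝ E] [AddCommGroup Z] [Module ℝ Z] [UniformSpace Z] [IsUniformAddGroup Z]
    [ContinuousConstSMul ℝ Z] [CompleteSpace Z] [T0Space Z] (e : X →ₗ[ℝ] E) (he : DenseRange e)
    (L : X →ₗ[ℝ] Z) (hL : ∀ U ∈ 𝓝 (0 : Z), ∃ V ∈ 𝓝 (0 : E), ∀ x, e x ∈ V → L x ∈ U) :
    ∃ T : E →L[ℝ] Z, ∀ x, T (e x) = L x := by
  let : UniformSpace E := IsTopologicalAddGroup.rightUniformSpace E
  have : IsUniformAddGroup E := isUniformAddGroup_of_addCommGroup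
  -- With the structure pulled back along `e`, the map `e` is uniformly inducing even if it is not
  -- injective.
  let : UniformSpace X := UniformSpace.comap e inferInstance
  have : IsUniformAddGroup X := IsUniformAddGroup.comap e
  have hind : IsUniformInducing e := ⟨rfl⟩
  have hcont : Continuous L := by
    refine continuous_of_continuousAt_zero L.toAddMonoidHom ?_
    change Tendsto L (𝓝 0) (𝓝 (L 0))
    rw [map_zero, hind.isInducing.nhds_eq_comap, map_zero]
    intro U hU
    obtain ⟨V, hV, h⟩ := hL U hU
    exact ⟨V, hV, h⟩
  let eL : X →L[ℝ] E := ⟨e, hind.isInducing.continuous⟩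
  let LL : X →L[ℝ] Z := ⟨L, hcont⟩
  exact ⟨LL.extend eL, fun x => ContinuousLinearMap.extend_eq LL (e := eL) he hind x⟩

/-- In a topological vector space with trivial dual, a subspace that becomes dense after adding a
finite-dimensional subspace carries no nonzero continuous functional. -/
theorem eq_zero_of_bounded_on_nhds_of_trivial_dual {E A : Type*} [AddCommGroup E] [Module ℝ E]
    [TopologicalSpace E] [IsTopologicalAddGroup E] [ContinuousSMul ℝ E]
    (hE : ∀ f : StrongDual ℝ E, f = 0) [AddCommGroup A] [Module ℝ A] (ι : A →ₗ[ℝ] E)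
    (F : Submodule ℝ E) [FiniteDimensional ℝ F]
    (hd : Dense ((LinearMap.range ι ⊔ F : Submodule ℝ E) : Set E)) (g : A →ₗ[ℝ] ℝ)
    (hg : ∃ U ∈ 𝓝 (0 : E), ∀ a, ι a ∈ U → |g a| ≤ 1) : g = 0 := by
  -- If the range is dense, `g` extends to a continuous functional on `E`, which must vanish.
  -- Otherwise its closure is proper and of finite codimension, so the quotient is a nonzero
  -- finite-dimensional Hausdorff space and yields a nonzero continuous functional on `E`.
  by_cases hC : Dense (LinearMap.range ι : Set E)
  · obtain ⟨f, hf⟩ := exists_extension_of_denseRange ι hC g (by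
      intro W hW
      obtain ⟨U, hU, hgU⟩ := hg
      obtain ⟨ε, hε, hW⟩ := Metric.mem_nhds_iff.1 hW
      refine ⟨(fun x : E => (2 / ε) • x) ⁻¹' U, ?_, fun a ha => hW ?_⟩
      · refine (continuous_const_smul (2 / ε : ℝ)).continuousAt.preimage_mem_nhds ?_
        simpa using hU
      · have h := hgU ((2 / ε) • a) (by simpa using ha)
        rw [map_smul, smul_eq_mul, abs_mul, abs_of_pos (by positivity : 0 < 2 / ε),
          div_mul_eq_mul_div, div_le_one hε] at h
        rw [mem_ball_zero_iff, Real.norm_eq_abs]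
        linarith)
    ext a
    rw [← hf, hE f]
    rfl
  · exfalso
    set C := (LinearMap.range ι).topologicalClosure
    have hCc : IsClosed (C : Set E) := (LinearMap.range ι).isClosed_topologicalClosure
    have := hCc
    have hCtop : C ≠ ⊤ := fun h => hC (Submodule.dense_iff_topologicalClosure_eq_top.2 h)
    have hsup : C ⊔ F = ⊤ := by
      have h1 := Submodule.isClosed_sup_finiteDimensional C F hCc
      have h2 : Dense ((C ⊔ F : Submodule ℝ E) : Set E) :=
        hd.mono (sup_le_sup_right (Submodule.le_topologicalClosure _) F)
      rw [← h1.submodule_topologicalClosure_eq]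
      exact Submodule.dense_iff_topologicalClosure_eq_top.1 h2
    have hF : F.map C.mkQ = ⊤ := by
      rw [eq_top_iff, ← Submodule.range_mkQ C, ← Submodule.map_top, ← hsup, Submodule.map_sup]
      simp
    have : FiniteDimensional ℝ (E ⧸ C) := by
      have : FiniteDimensional ℝ (F.map C.mkQ) := inferInstance
      rw [hF] at this
      exact Module.finite_def.2 (Module.Finite.iff_fg.1 this)
    obtain ⟨x, hx⟩ : ∃ x, x ∉ C := by
      by_contra! h
      exact hCtop (Submodule.eq_top_iff'.2 h)
    have hx' : C.mkQ x ≠ 0 := by simpa using hx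
    obtain ⟨φ, hφ⟩ : ∃ φ : Module.Dual ℝ (E ⧸ C), φ (C.mkQ x) ≠ 0 := by
      by_contra! h
      exact hx' ((Module.forall_dual_apply_eq_zero_iff ℝ _).1 h)
    let f : StrongDual ℝ E :=
      ⟨φ ∘ₗ C.mkQ, (LinearMap.continuous_of_finiteDimensional φ).comp continuous_quot_mk⟩
    exact hφ (DFunLike.congr_fun (hE f) x)

/-! ### The norm of `c₀₀` and operators on `ℓ₁`. -/

theorem l1Norm_eq_sum_of_support_subset {u : ℕ →₀ ℝ} {s : Finset ℕ} (h : u.support ⊆ s) :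
    l1Norm u = ∑ j ∈ s, |u j| := by
  refine Finset.sum_subset h fun j _ hj => ?_
  rw [Finsupp.notMem_support_iff.1 hj, abs_zero]

theorem l1Norm_single (j : ℕ) (c : ℝ) : l1Norm (Finsupp.single j c) = |c| := by
  rw [l1Norm_eq_sum_of_support_subset Finsupp.support_single_subset]
  simp

theorem abs_apply_le_l1Norm (u : ℕ →₀ ℝ) (j : ℕ) : |u j| ≤ l1Norm u := by
  by_cases h : j ∈ u.support
  · exact Finset.single_le_sum (f := fun j => |u j|) (fun _ _ => abs_nonneg _) h
  · rw [Finsupp.notMem_support_iff.1 h, abs_zero]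
    exact l1Norm_nonneg u

theorem eq_zero_of_l1Norm_eq_zero {u : ℕ →₀ ℝ} (h : l1Norm u = 0) : u = 0 := by
  ext j
  have := abs_apply_le_l1Norm u j
  rw [h] at this
  exact abs_nonpos_iff.1 this

theorem norm_linearCombination_le {E : Type*} [SeminormedAddCommGroup E] [NormedSpace ℝ E]
    (w : ℕ → E) {C : ℝ} (hw : ∀ j, ‖w j‖ ≤ C) (u : ℕ →₀ ℝ) :
    ‖Finsupp.linearCombination ℝ w u‖ ≤ C * l1Norm u := by
  rw [Finsupp.linearCombination_apply, Finsupp.sum, l1Norm, Finset.mul_sum]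
  refine (norm_sum_le _ _).trans (Finset.sum_le_sum fun j _ => ?_)
  rw [norm_smul, Real.norm_eq_abs, mul_comm]
  exact mul_le_mul_of_nonneg_right (hw j) (abs_nonneg _)

theorem toEllOne_single (j : ℕ) : toEllOne (Finsupp.single j 1) = lp.single 1 j (1 : ℝ) := by
  ext i
  change (Finsupp.single j (1 : ℝ)) i = _
  rw [lp.single_apply, Finsupp.single_apply, Pi.single_apply]
  simp [eq_comm]

theorem toEllOne_apply (u : ℕ →₀ ℝ) (j : ℕ) : toEllOne u j = u j := rfl

theorem toEllOne_eq_linearCombination (u : ℕ →₀ ℝ) :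
    toEllOne u = Finsupp.linearCombination ℝ (fun j => toEllOne (Finsupp.single j 1)) u := by
  conv_lhs => rw [← Finsupp.sum_single u]
  simp only [Finsupp.linearCombination_apply, Finsupp.sum, map_sum, ← map_smul,
    Finsupp.smul_single, smul_eq_mul, mul_one]

theorem toEllOne_injective : Function.Injective toEllOne := fun u v h => by
  ext j
  rw [← toEllOne_apply, h, toEllOne_apply]

theorem continuous_ellOne_apply (j : ℕ) : Continuous fun x : EllOne => x j :=
  (continuous_apply j).comp (lp.uniformContinuous_coe (p := 1)).continuous

theorem hasSum_toEllOne_single (x : EllOne) :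
    HasSum (fun j => x j • toEllOne (Finsupp.single j 1)) x := by
  convert! lp.hasSum_single (p := 1) (by simp) x using 2 with j
  rw [toEllOne_single, ← lp.single_smul, smul_eq_mul, mul_one]

theorem denseRange_toEllOne : DenseRange toEllOne := fun x => by
  refine mem_closure_of_tendsto (hasSum_toEllOne_single x) (Eventually.of_forall fun s => ?_)
  exact ⟨∑ j ∈ s, x j • Finsupp.single j 1, by simp only [map_sum, map_smul]⟩

theorem exists_ellOne_operator (w : ℕ → EllOne) (hw : ∀ j, ‖w j‖ ≤ 1) :
    ∃ S : EllOne →L[ℝ] EllOne, (∀ x, ‖S x‖ ≤ ‖x‖) ∧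
      ∀ u, S (toEllOne u) = Finsupp.linearCombination ℝ w u := by
  have h : ∀ u, ‖Finsupp.linearCombination ℝ w u‖ ≤ 1 * ‖toEllOne u‖ := fun u => by
    rw [norm_toEllOne]; exact norm_linearCombination_le w hw u
  refine ⟨(Finsupp.linearCombination ℝ w).extendOfNorm toEllOne, fun x => ?_, fun u => ?_⟩
  · simpa using LinearMap.norm_extendOfNorm_apply_le denseRange_toEllOne 1 h x
  · exact LinearMap.extendOfNorm_eq denseRange_toEllOne ⟨1, h⟩ u

/-! ### Block sequences. -/

/-- Normalized disjointly supported sequences in `c₀₀`. -/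
structure IsNormalizedBlock (v : ℕ → ℕ →₀ ℝ) : Prop where
  l1Norm_eq : ∀ n, l1Norm (v n) = 1
  eq_of_ne_zero : ∀ m n j, v m j ≠ 0 → v n j ≠ 0 → m = n

namespace IsNormalizedBlock

variable {v : ℕ → ℕ →₀ ℝ}

/-- Send the `j`-th unit vector, for `j` in the support of `v n`, to the sign of `v n j` times the
unit vector at `σ n`; the signs turn `v n` into its norm, which is 1. Taking `σ = id` inverts the
block embedding, and `σ = Nat.succ` produces a shift. -/
theorem exists_operator (hv : IsNormalizedBlock v) (σ : ℕ → ℕ) :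
    ∃ S : EllOne →L[ℝ] EllOne, (∀ x, ‖S x‖ ≤ ‖x‖) ∧
      ∀ n, S (toEllOne (v n)) = toEllOne (Finsupp.single (σ n) 1) := by
  classical
  let w : ℕ → EllOne := fun j => if h : ∃ n, v n j ≠ 0 then
    Real.sign (v h.choose j) • toEllOne (Finsupp.single (σ h.choose) 1) else 0
  have hw : ∀ n j, v n j ≠ 0 →
      w j = Real.sign (v n j) • toEllOne (Finsupp.single (σ n) 1) := by
    intro n j h
    have h' : ∃ n, v n j ≠ 0 := ⟨n, h⟩
    have e : h'.choose = n := hv.eq_of_ne_zero _ _ j h'.choose_spec h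
    simp only [w, dif_pos h', e]
  obtain ⟨S, hS, hSu⟩ := exists_ellOne_operator w (by
    intro j
    by_cases h : ∃ n, v n j ≠ 0
    · obtain ⟨n, h⟩ := h
      rw [hw n j h, norm_smul, norm_toEllOne, l1Norm_single]
      rcases Real.sign_apply_eq_of_ne_zero _ h with h | h <;> simp [h]
    · simp only [w, dif_neg h, norm_zero, zero_le_one])
  refine ⟨S, hS, fun n => ?_⟩
  rw [hSu, Finsupp.linearCombination_apply, Finsupp.sum]
  calc ∑ j ∈ (v n).support, v n j • w j
      = ∑ j ∈ (v n).support, |v n j| • toEllOne (Finsupp.single (σ n) 1) := by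
        refine Finset.sum_congr rfl fun j hj => ?_
        rw [hw n j (Finsupp.mem_support_iff.1 hj), smul_smul]
        congr 1
        rcases lt_or_ge (v n j) 0 with h | h
        · rw [Real.sign_of_neg h, abs_of_neg h]; ring
        · rcases h.eq_or_lt with h | h
          · rw [← h, zero_mul, abs_zero]
          · rw [Real.sign_of_pos h, abs_of_pos h, mul_one]
    _ = l1Norm (v n) • toEllOne (Finsupp.single (σ n) 1) := by rw [l1Norm, Finset.sum_smul]
    _ = _ := by rw [hv.l1Norm_eq, one_smul]

/-- One inequality is the triangle inequality; the other comes from the contraction that sends each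
`v n` back to the `n`-th unit vector. -/
theorem l1Norm_linearCombination (hv : IsNormalizedBlock v) (a : ℕ →₀ ℝ) :
    l1Norm (Finsupp.linearCombination ℝ v a) = l1Norm a := by
  have hcomp : ∀ (f : EllOne →ₗ[ℝ] EllOne), f (toEllOne (Finsupp.linearCombination ℝ v a)) =
      Finsupp.linearCombination ℝ (fun n => f (toEllOne (v n))) a := by
    intro f
    simp only [Finsupp.linearCombination_apply, Finsupp.sum, map_sum, map_smul]
  apply le_antisymm
  · have h := norm_linearCombination_le (fun n => toEllOne (v n)) (C := 1)
      (fun n => by rw [norm_toEllOne, hv.l1Norm_eq]) a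
    rw [one_mul] at h
    rwa [← norm_toEllOne, show toEllOne _ = _ from hcomp LinearMap.id]
  · obtain ⟨S, hS, hSv⟩ := hv.exists_operator id
    have h := hS (toEllOne (Finsupp.linearCombination ℝ v a))
    rw [show S _ = _ from hcomp S] at h
    simp only [ContinuousLinearMap.coe_coe, hSv, norm_toEllOne] at h
    refine le_trans (le_of_eq ?_) h
    rw [← norm_toEllOne]
    congr 1
    exact toEllOne_eq_linearCombination a

theorem comp (hv : IsNormalizedBlock v) {w : ℕ → ℕ →₀ ℝ} (hw : IsNormalizedBlock w) :
    IsNormalizedBlock fun n => Finsupp.linearCombination ℝ v (w n) := by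
  have key : ∀ n j, Finsupp.linearCombination ℝ v (w n) j ≠ 0 →
      ∃ k, w n k ≠ 0 ∧ v k j ≠ 0 := by
    intro n j h
    rw [Finsupp.linearCombination_apply, Finsupp.sum, Finsupp.finsetSum_apply] at h
    obtain ⟨k, -, hk⟩ := Finset.exists_ne_zero_of_sum_ne_zero h
    rw [Finsupp.smul_apply, smul_eq_mul] at hk
    exact ⟨k, left_ne_zero_of_mul hk, right_ne_zero_of_mul hk⟩
  refine ⟨fun n => by rw [hv.l1Norm_linearCombination, hw.l1Norm_eq], fun m n j hm hn => ?_⟩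
  obtain ⟨k, hk, hkj⟩ := key m j hm
  obtain ⟨l, hl, hlj⟩ := key n j hn
  rw [hv.eq_of_ne_zero k l j hkj hlj] at hk
  exact hw.eq_of_ne_zero m n l hk hl

theorem single : IsNormalizedBlock fun n => Finsupp.single n 1 :=
  ⟨fun n => by rw [l1Norm_single, abs_one], fun m n j hm hn => by
    rw [Finsupp.single_apply_ne_zero] at hm hn
    exact hm.1.symm.trans hn.1⟩

/-- Every linear functional on `c₀₀` vanishes on a normalized block sequence. -/
theorem exists_map_eq_zero (α : (ℕ →₀ ℝ) →ₗ[ℝ] ℝ) :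
    ∃ w, IsNormalizedBlock w ∧ ∀ n, α (w n) = 0 := by
  -- A functional on a plane has a kernel vector of norm 1; this is applied on the disjoint
  -- coordinate planes `{2n, 2n+1}`.
  have h : ∀ s t : ℝ, ∃ c d : ℝ, |c| + |d| = 1 ∧ c * s + d * t = 0 := by
    intro s t
    by_cases hst : s = 0
    · exact ⟨1, 0, by simp, by simp [hst]⟩
    · have hp : 0 < |t| + |s| := by positivity
      refine ⟨t / (|t| + |s|), -s / (|t| + |s|), ?_, by ring⟩
      rw [abs_div, abs_div, abs_neg, abs_of_pos hp, ← add_div, div_self hp.ne']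
  choose c d hcd h0 using fun n : ℕ =>
    h (α (Finsupp.single (2 * n) 1)) (α (Finsupp.single (2 * n + 1) 1))
  refine ⟨fun n => Finsupp.single (2 * n) (c n) + Finsupp.single (2 * n + 1) (d n), ⟨?_, ?_⟩, ?_⟩
  · intro n
    rw [l1Norm_eq_sum_of_support_subset (s := {2 * n, 2 * n + 1}), Finset.sum_pair (by omega)]
    · simpa [Finsupp.single_apply] using hcd n
    · refine Finsupp.support_add.trans (Finset.union_subset ?_ ?_) <;>
        refine Finsupp.support_single_subset.trans ?_ <;> simp
  · intro m n j hm hn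
    simp only [Finsupp.add_apply, Finsupp.single_apply] at hm hn
    split_ifs at hm hn <;> first | omega | simp at hm hn
  · intro n
    rw [map_add, ← h0 n]
    simp only [← smul_eq_mul, ← map_smul, Finsupp.smul_single]
    simp only [smul_eq_mul, mul_one]
end IsNormalizedBlock

/-- The unit vector basis of `ℓ₁`. -/
noncomputable abbrev ellOneUnit (n : ℕ) : EllOne := toEllOne (Finsupp.single n 1)

theorem ellOneUnit_apply (n j : ℕ) : ellOneUnit n j = if n = j then 1 else 0 := by
  rw [toEllOne_apply, Finsupp.single_apply]

theorem norm_ellOneUnit (n : ℕ) : ‖ellOneUnit n‖ = 1 := by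
  rw [norm_toEllOne, l1Norm_single, abs_one]

/-- The coordinate `φ n` keeps the images of distinct unit vectors at distance at least 1, so no
subsequence is Cauchy. -/
theorem not_isCompactOperator_of_separated {C : EllOne →L[ℝ] EllOne} (φ : ℕ → ℕ)
    (h : ∀ m n, m < n → (C (ellOneUnit n) - C (ellOneUnit m)) (φ n) = 1) :
    ¬ IsCompactOperator C := by
  intro hC
  have hK := hC.isCompact_closure_image_closedBall 1
  obtain ⟨a, -, ψ, hψ, ha⟩ := hK.tendsto_subseq (x := fun n => C (ellOneUnit n)) fun n =>
    subset_closure ⟨_, by simp [norm_ellOneUnit], rfl⟩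
  obtain ⟨N, hN⟩ := Metric.cauchySeq_iff'.1 ha.cauchySeq 1 one_pos
  have h1 := hN (N + 1) (Nat.le_succ N)
  rw [dist_eq_norm] at h1
  have h2 := lp.norm_apply_le_norm (p := 1) one_ne_zero
    (C (ellOneUnit (ψ (N + 1))) - C (ellOneUnit (ψ N))) (φ (ψ (N + 1)))
  rw [h _ _ (hψ (Nat.lt_succ_self N)), norm_one] at h2
  exact absurd h1 (not_lt.2 h2)

theorem not_finiteDimensional_finsupp : ¬ FiniteDimensional ℝ (ℕ →₀ ℝ) := fun _ =>
  not_finite_iff_infinite.2 (inferInstance : Infinite ℕ)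
    (Module.Finite.finite_basis (Finsupp.basisSingleOne (R := ℝ) (ι := ℕ)))

/-! ### Consequences of a complemented copy of `ℓ₁`. -/

section ComplementedCopy

variable {E : Type*} [AddCommGroup E] [Module ℝ E] [TopologicalSpace E]
  {T : EllOne →L[ℝ] E} {U : E →L[ℝ] EllOne}

theorem not_finiteDimensional_range_of_leftInverse (h : ∀ x, U (T x) = x) :
    ¬ FiniteDimensional ℝ (LinearMap.range (T : EllOne →ₗ[ℝ] E)) := by
  intro hf
  have hinj : Function.Injective (T : EllOne →ₗ[ℝ] E) := fun x y hxy => by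
    rw [← h x, ← h y]; exact congrArg U hxy
  have : FiniteDimensional ℝ EllOne :=
    (LinearEquiv.ofInjective _ hinj).symm.finiteDimensional
  exact not_finiteDimensional_finsupp
    (FiniteDimensional.of_injective toEllOne toEllOne_injective)

theorem isClosed_range_of_leftInverse [T2Space E] (h : ∀ x, U (T x) = x) :
    IsClosed (LinearMap.range (T : EllOne →ₗ[ℝ] E) : Set E) := by
  have : (LinearMap.range (T : EllOne →ₗ[ℝ] E) : Set E) = {y | T (U y) = y} := by
    ext y
    constructor
    · rintro ⟨x, rfl⟩
      exact congrArg T (h x)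
    · exact fun hy => ⟨U y, hy⟩
  rw [this]
  exact isClosed_eq (T.continuous.comp U.continuous) continuous_id

/-- `T` carries coordinate expansions in `ℓ₁` over to its closed range; uniqueness follows by
applying `U` and reading off coordinates. -/
theorem isBasicSequence_of_leftInverse [T2Space E] (h : ∀ x, U (T x) = x) :
    IsBasicSequence E fun n => T (ellOneUnit n) := by
  intro y hy
  have hsub : (Submodule.span ℝ (Set.range fun n => T (ellOneUnit n)) : Set E) ⊆
      (LinearMap.range (T : EllOne →ₗ[ℝ] E) : Set E) := by
    refine SetLike.coe_subset_coe.2 (Submodule.span_le.2 ?_)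
    rintro _ ⟨n, rfl⟩
    exact ⟨_, rfl⟩
  obtain ⟨b, rfl⟩ := closure_minimal hsub (isClosed_range_of_leftInverse h) hy
  change ∃! a : ℕ → ℝ, Tendsto _ _ (𝓝 (T b))
  have hsum : ∀ (a : ℕ → ℝ) n, ∑ i ∈ Finset.range n, a i • T (ellOneUnit i) =
      T (∑ i ∈ Finset.range n, a i • ellOneUnit i) := fun a n => by simp only [map_sum, map_smul]
  refine ⟨fun j => b j, ?_, fun a ha => ?_⟩
  · simp only [hsum]
    exact (T.continuous.tendsto b).comp (hasSum_toEllOne_single b).tendsto_sum_nat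
  · simp only [hsum] at ha
    have h1 := (U.continuous.tendsto _).comp ha
    rw [h] at h1
    funext j
    have h2 := ((continuous_ellOne_apply j).tendsto b).comp h1
    refine tendsto_nhds_unique (tendsto_const_nhds.congr' ?_) h2
    filter_upwards [eventually_gt_atTop j] with n hn
    simp only [Function.comp_apply, h]
    rw [lp.coeFn_sum, Finset.sum_apply]
    rw [Finset.sum_eq_single j]
    · change a j = a j * ellOneUnit j j
      rw [ellOneUnit_apply, if_pos rfl, mul_one]
    · intro i _ hij
      change a i * ellOneUnit i j = 0
      rw [ellOneUnit_apply, if_neg hij, mul_zero]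
    · simp [hn]

/-- Keep the topology on the kernel of `U` and replace that of the copy of `ℓ₁` by coordinatewise
convergence. The images of the unit vectors then tend to `0`, although `U` sends them back to
vectors of norm 1. -/
theorem not_isTopologicallyMinimal_of_leftInverse [IsTopologicalAddGroup E] [ContinuousSMul ℝ E]
    [T2Space E] (h : ∀ x, U (T x) = x) :
    ¬ IsTopologicallyMinimal E (inferInstance : TopologicalSpace E) := by
  let coord : EllOne →ₗ[ℝ] (ℕ → ℝ) :=
    { toFun := fun x j => x j, map_add' := fun _ _ => rfl, map_smul' := fun _ _ => rfl }
  have hcoord : Continuous coord := continuous_pi continuous_ellOne_apply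
  let Ψ : E →ₗ[ℝ] E × (ℕ → ℝ) :=
    (LinearMap.id - (T : EllOne →ₗ[ℝ] E) ∘ₗ (U : E →ₗ[ℝ] EllOne)).prod
      (coord ∘ₗ (U : E →ₗ[ℝ] EllOne))
  have hΨ : ∀ y, Ψ y = (y - T (U y), coord (U y)) := fun _ => rfl
  have hcont : Continuous Ψ := (continuous_id.sub (T.continuous.comp U.continuous)).prodMk
    (hcoord.comp U.continuous)
  have hinj : Function.Injective Ψ := by
    refine (injective_iff_map_eq_zero Ψ).2 fun y hy => ?_
    rw [hΨ, Prod.mk_eq_zero] at hy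
    have h0 : U y = 0 := by
      ext j
      exact congrFun hy.2 j
    simpa [h0] using hy.1
  refine not_not.2 ⟨.induced Ψ inferInstance, ⟨?_, ?_⟩, ?_, ?_⟩
  · exact topologicalAddGroup_induced Ψ
  · exact continuousSMul_induced Ψ
  · exact @T2Space.of_injective_continuous _ _ (.induced Ψ inferInstance) _ _ _ hinj
      continuous_induced_dom
  · refine lt_of_le_not_ge (continuous_iff_le_induced.1 hcont) fun hle => ?_
    have h1 : Tendsto (fun n => T (ellOneUnit n)) atTop
        (@nhds E (.induced Ψ inferInstance) 0) := by
      rw [nhds_induced, tendsto_comap_iff, map_zero]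
      refine Tendsto.prodMk_nhds ?_ (tendsto_pi_nhds.2 fun j => ?_)
      · refine tendsto_const_nhds.congr fun n => ?_
        change 0 = T (ellOneUnit n) - T (U (T (ellOneUnit n)))
        rw [h, sub_self]
      · refine tendsto_const_nhds.congr' ?_
        filter_upwards [eventually_gt_atTop j] with n hn
        change 0 = U (T (ellOneUnit n)) j
        rw [h, ellOneUnit_apply, if_neg hn.ne']
    have h2 := ((U.continuous.tendsto 0).comp (h1.mono_right (nhds_mono hle))).norm
    simp only [Function.comp_def, h, norm_ellOneUnit, map_zero, norm_zero] at h2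
    exact one_ne_zero (tendsto_nhds_unique tendsto_const_nhds h2)

theorem not_isCompactOperator_of_leftInverse (h : ∀ x, U (T x) = x) : ¬ IsCompactOperator T := by
  intro hT
  refine not_isCompactOperator_of_separated (C := U.comp T) id (fun m n hmn => ?_)
    (hT.clm_comp U)
  simp only [ContinuousLinearMap.comp_apply, h, id]
  change ellOneUnit n n - ellOneUnit m n = 1
  rw [ellOneUnit_apply, ellOneUnit_apply, if_pos rfl, if_neg hmn.ne, sub_zero]

/-- Compressing to the copy of `ℓ₁` would make the shift minus `c` times the identity compact.
Coordinate `n + 1` of the image of the `n`-th unit vector is 1, and it vanishes for all earlier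
images. -/
theorem not_scalarPlusCompact_of_leftInverse (h : ∀ x, U (T x) = x) {V : E →L[ℝ] EllOne}
    (hV : ∀ n, V (T (ellOneUnit n)) = ellOneUnit (n + 1)) :
    ¬ ∃ (c : ℝ) (S : E →L[ℝ] E), IsCompactOperator S ∧ ∀ y, T (V y) = c • y + S y := by
  rintro ⟨c, S, hS, hy⟩
  refine not_isCompactOperator_of_separated (C := U.comp (S.comp T)) (fun n => n + 1)
    (fun m n hmn => ?_) ((hS.comp_clm T).clm_comp U)
  have key : ∀ n, U (S (T (ellOneUnit n))) = ellOneUnit (n + 1) - c • ellOneUnit n := by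
    intro n
    have := congrArg U (hy (T (ellOneUnit n)))
    rw [map_add, map_smul, h, h, hV] at this
    rw [this, add_sub_cancel_left]
  simp only [ContinuousLinearMap.comp_apply, key]
  change ellOneUnit (n + 1) (n + 1) - c * ellOneUnit n (n + 1) -
    (ellOneUnit (m + 1) (n + 1) - c * ellOneUnit m (n + 1)) = 1
  simp only [ellOneUnit_apply]
  rw [if_pos trivial, if_neg (by omega), if_neg (by omega), if_neg (by omega)]
  ring

end ComplementedCopy

/-! ### Boundedness on blocks and the seven conditions. -/

/-- `Φ` is bounded on the span of a normalized block sequence. -/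
def BoundedOnBlock (Φ : QuasilinearMap) : Prop :=
  ∃ v, IsNormalizedBlock v ∧
    ∃ K, ∀ a, |Φ (Finsupp.linearCombination ℝ v a)| ≤ K * l1Norm a

/-- On blocks of `v` formed inside the kernel of `α`, the hypothesis bounds `Φ` itself. -/
theorem boundedOnBlock_of_linear (Φ : QuasilinearMap) {v : ℕ → ℕ →₀ ℝ}
    (hv : IsNormalizedBlock v) (α : (ℕ →₀ ℝ) →ₗ[ℝ] ℝ) {K : ℝ}
    (hα : ∀ a, |α a - Φ (Finsupp.linearCombination ℝ v a)| ≤ K * l1Norm a) :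
    BoundedOnBlock Φ := by
  obtain ⟨w, hw, hw0⟩ := IsNormalizedBlock.exists_map_eq_zero α
  refine ⟨_, hv.comp hw, K, fun a => ?_⟩
  have h1 : Finsupp.linearCombination ℝ (fun n => Finsupp.linearCombination ℝ v (w n)) a =
      Finsupp.linearCombination ℝ v (Finsupp.linearCombination ℝ w a) := by
    simp only [Finsupp.linearCombination_apply ℝ (v := w),
      Finsupp.linearCombination_apply ℝ (v := fun n => Finsupp.linearCombination ℝ v (w n)),
      Finsupp.sum, map_sum, map_smul]
  have h2 : α (Finsupp.linearCombination ℝ w a) = 0 := by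
    simp only [Finsupp.linearCombination_apply, Finsupp.sum, map_sum, map_smul, hw0, smul_zero,
      Finset.sum_const_zero]
  have h3 := hα (Finsupp.linearCombination ℝ w a)
  rwa [h2, zero_sub, abs_neg, hw.l1Norm_linearCombination, ← h1] at h3

theorem BoundedOnBlock.not_nowhereBounded {Φ : QuasilinearMap} (h : BoundedOnBlock Φ) :
    ¬ TwistedSum.NowhereBounded Φ := by
  obtain ⟨v, hv, K, hK⟩ := h
  refine not_not.2 ⟨LinearMap.range (Finsupp.linearCombination ℝ v), fun hf => ?_, K, ?_⟩
  · have hinj : Function.Injective (Finsupp.linearCombination ℝ v) := by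
      refine (injective_iff_map_eq_zero _).2 fun a ha => eq_zero_of_l1Norm_eq_zero ?_
      rw [← hv.l1Norm_linearCombination, ha, ← norm_toEllOne, map_zero, norm_zero]
    exact not_finiteDimensional_finsupp
      (Module.Finite.equiv (LinearEquiv.ofInjective _ hinj).symm)
  · rintro _ ⟨a, rfl⟩
    rw [hv.l1Norm_linearCombination]
    exact hK a

namespace TwistedSum

variable (Φ : QuasilinearMap)

/-- The canonical map of `ℝ ⊕ c₀₀` into its completion. -/
noncomputable def coeLin : PreTwistedSum Φ →ₗ[ℝ] TwistedSum Φ where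
  toFun x := x
  map_add' x y := UniformSpace.Completion.coe_add x y
  map_smul' a x := UniformSpace.Completion.coe_smul a x

theorem denseRange_coeLin : DenseRange (coeLin Φ) := UniformSpace.Completion.denseRange_coe

theorem exists_quasinorm_lt_of_mem_nhds {U : Set (TwistedSum Φ)} (hU : U ∈ 𝓝 0) :
    ∃ ε > 0, ∀ x, PreTwistedSum.quasinorm Φ x < ε → coeLin Φ x ∈ U := by
  have h : Tendsto (coeLin Φ) (𝓝 0) (𝓝 (coeLin Φ 0)) :=
    (UniformSpace.Completion.continuous_coe _).tendsto 0
  rw [map_zero] at h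
  obtain ⟨ε, hε, h⟩ := (PreTwistedSum.nhds_zero_hasBasis Φ).mem_iff.1 (h hU)
  exact ⟨ε, hε, fun x hx => h hx⟩

theorem map_zero_eq : Φ 0 = 0 := by
  simpa using Φ.map_smul 0 0

theorem quasinorm_mk (α : ℝ) (u : ℕ →₀ ℝ) :
    PreTwistedSum.quasinorm Φ (PreTwistedSum.mk Φ α u) = |α - Φ u| + l1Norm u := rfl

theorem e₀_ne_zero : e₀ Φ ≠ 0 := by
  intro h
  have hi : Inseparable (PreTwistedSum.mk Φ 1 0) 0 := by
    refine (UniformSpace.Completion.isUniformInducing_coe _).isInducing.inseparable_iff.1 ?_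
    rw [UniformSpace.Completion.coe_zero]
    exact .of_eq h
  have hmem := (PreTwistedSum.nhds_zero_hasBasis Φ).mem_of_mem one_pos
  rw [← hi.nhds_eq] at hmem
  have := mem_of_mem_nhds hmem
  rw [Set.mem_ofPred_eq, quasinorm_mk, map_zero_eq, sub_zero, abs_one] at this
  linarith [l1Norm_nonneg 0]

theorem quotientMap_e₀ : quotientMap Φ (e₀ Φ) = 0 :=
  (quotientMap_coe Φ _).trans (map_zero toEllOne)

/-- The map `u ↦ (0, u)`. -/
noncomputable def inr : (ℕ →₀ ℝ) →ₗ[ℝ] PreTwistedSum Φ := LinearMap.inr ℝ ℝ (ℕ →₀ ℝ)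

theorem inr_apply (u : ℕ →₀ ℝ) : inr Φ u = PreTwistedSum.mk Φ 0 u := rfl

/-- The vector `(Φ u, u)` has quasinorm `‖u‖₁`, so `f` is bounded on it by a multiple of `‖u‖₁`. As
`(0, u) = (Φ u, u) - Φ u • e₀`, the linear functional `u ↦ -f (0, u) / f e₀` is at bounded distance
from `Φ`. -/
theorem boundedOnBlock_of_map_e₀_ne_zero (f : StrongDual ℝ (TwistedSum Φ)) (hf : f (e₀ Φ) ≠ 0) :
    BoundedOnBlock Φ := by
  obtain ⟨ε, hε, h⟩ := exists_quasinorm_lt_of_mem_nhds Φ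
    (U := f ⁻¹' Metric.ball 0 1) (f.continuous.continuousAt.preimage_mem_nhds (by
      rw [map_zero]; exact Metric.ball_mem_nhds _ one_pos))
  have hid : ∀ u : ℕ →₀ ℝ, Finsupp.linearCombination ℝ (fun n => Finsupp.single n (1 : ℝ)) u = u := by
    intro u
    simp [Finsupp.linearCombination_apply]
  refine boundedOnBlock_of_linear Φ IsNormalizedBlock.single
    (-(f (e₀ Φ))⁻¹ • ((f : TwistedSum Φ →ₗ[ℝ] ℝ) ∘ₗ coeLin Φ ∘ₗ inr Φ))
    (K := |f (e₀ Φ)|⁻¹ * (2 / ε)) fun u => ?_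
  rw [hid]
  have key : |f (coeLin Φ (PreTwistedSum.mk Φ (Φ u) u))| ≤ 2 / ε * l1Norm u := by
    rcases (l1Norm_nonneg u).eq_or_lt with h0 | h0
    · rw [← h0, eq_zero_of_l1Norm_eq_zero h0.symm, map_zero_eq]
      have : PreTwistedSum.mk Φ 0 0 = 0 := rfl
      simp [this]
    · have h1 := h ((ε / (2 * l1Norm u)) • PreTwistedSum.mk Φ (Φ u) u) (by
        rw [PreTwistedSum.quasinorm_smul, quasinorm_mk, sub_self, abs_zero, zero_add,
          abs_of_pos (by positivity)]
        field_simp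
        norm_num)
      rw [Set.mem_preimage, mem_ball_zero_iff, map_smul, map_smul, norm_smul, Real.norm_eq_abs,
        Real.norm_eq_abs, abs_of_pos (by positivity)] at h1
      have : |f (coeLin Φ (PreTwistedSum.mk Φ (Φ u) u))| = 2 / ε * l1Norm u *
          (ε / (2 * l1Norm u) * |f (coeLin Φ (PreTwistedSum.mk Φ (Φ u) u))|) := by
        field_simp
      rw [this]
      exact mul_le_of_le_one_right (by positivity) h1.le
  have hdecomp : coeLin Φ (inr Φ u) = coeLin Φ (PreTwistedSum.mk Φ (Φ u) u) - Φ u • e₀ Φ := by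
    have h1 : inr Φ u = PreTwistedSum.mk Φ (Φ u) u - Φ u • PreTwistedSum.mk Φ 1 0 :=
      Prod.ext (by change (0 : ℝ) = Φ u - Φ u * 1; ring)
        (by change u = u - Φ u • 0; rw [smul_zero, sub_zero])
    rw [h1, map_sub, map_smul]
    rfl
  have : (-(f (e₀ Φ))⁻¹ • ((f : TwistedSum Φ →ₗ[ℝ] ℝ) ∘ₗ coeLin Φ ∘ₗ inr Φ)) u - Φ u =
      -((f (e₀ Φ))⁻¹ * f (coeLin Φ (PreTwistedSum.mk Φ (Φ u) u))) := by
    change -(f (e₀ Φ))⁻¹ * f (coeLin Φ (inr Φ u)) - Φ u = _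
    rw [hdecomp, map_sub, map_smul, smul_eq_mul]
    field_simp
    ring
  rw [this, abs_neg, abs_mul, abs_inv, mul_assoc]
  exact mul_le_mul_of_nonneg_left key (by positivity)

/-- Boundedness of `Φ` on the blocks makes `a ↦ (0, ∑ aₙ vₙ)` continuous from `ℓ₁` to `Y`, and `π`
followed by the operator sending `v n` to the `n`-th unit vector is a left inverse. -/
theorem not_condition_of_boundedOnBlock [ContinuousSMul ℝ (TwistedSum Φ)]
    (hb : BoundedOnBlock Φ) :
    ¬ (NoBasicSequence Φ ∨ ClosedSubspacesContain Φ ∨ IsStrictlySingular (quotientMap Φ) ∨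
      IsTopologicallyMinimal (TwistedSum Φ) (topology Φ) ∨ NowhereBounded Φ ∨
      OperatorsFromEllOneCompact Φ ∨ OperatorsScalarPlusCompact Φ) := by
  have h5 := hb.not_nowhereBounded
  obtain ⟨v, hv, K, hK⟩ := hb
  obtain ⟨T, hT⟩ := exists_extension_of_denseRange toEllOne denseRange_toEllOne
    (coeLin Φ ∘ₗ inr Φ ∘ₗ Finsupp.linearCombination ℝ v) (by
      intro W hW
      obtain ⟨ε, hε, h⟩ := exists_quasinorm_lt_of_mem_nhds Φ hW
      refine ⟨_, Metric.ball_mem_nhds 0 (show 0 < ε / (|K| + 1) by positivity), fun a ha => ?_⟩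
      rw [mem_ball_zero_iff, norm_toEllOne, lt_div_iff₀ (by positivity)] at ha
      refine h _ ?_
      change PreTwistedSum.quasinorm Φ (inr Φ (Finsupp.linearCombination ℝ v a)) < ε
      rw [inr_apply, quasinorm_mk, zero_sub, abs_neg, hv.l1Norm_linearCombination]
      have h1 := mul_le_mul_of_nonneg_right (le_abs_self K) (l1Norm_nonneg a)
      linarith [hK a])
  have hπT : ∀ a, quotientMap Φ (T (toEllOne a)) =
      toEllOne (Finsupp.linearCombination ℝ v a) := fun a => by
    rw [hT]; exact quotientMap_coe Φ _
  obtain ⟨S, -, hS⟩ := hv.exists_operator id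
  obtain ⟨S', -, hS'⟩ := hv.exists_operator Nat.succ
  have hunit : ∀ n, quotientMap Φ (T (ellOneUnit n)) = toEllOne (v n) := fun n => by
    rw [hπT, Finsupp.linearCombination_single, one_smul]
  have hU : ∀ x, (S.comp (quotientMap Φ)) (T x) = x := by
    have : (S.comp (quotientMap Φ)).comp T = ContinuousLinearMap.id ℝ EllOne := by
      refine ContinuousLinearMap.coeFn_injective (denseRange_toEllOne.equalizer
        (ContinuousLinearMap.continuous _) (ContinuousLinearMap.continuous _) ?_)
      funext a
      simp only [Function.comp_apply, ContinuousLinearMap.comp_apply,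
        ContinuousLinearMap.coe_id', id]
      rw [toEllOne_eq_linearCombination a]
      simp only [Finsupp.linearCombination_apply, Finsupp.sum, map_sum, map_smul]
      exact Finset.sum_congr rfl fun n _ => by rw [hunit, hS, id]
    exact fun x => DFunLike.congr_fun this x
  have hU0 : (S.comp (quotientMap Φ)) (e₀ Φ) = 0 := by
    rw [ContinuousLinearMap.comp_apply, quotientMap_e₀, map_zero]
  rintro (h | h | h | h | h | h | h)
  · exact h ⟨_, isBasicSequence_of_leftInverse hU⟩
  -- The left inverse factors through `π` and so kills `e₀`; hence `e₀` is not in the range of `T`.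
  · obtain ⟨x, hx⟩ := h _ (isClosed_range_of_leftInverse hU)
      (not_finiteDimensional_range_of_leftInverse hU)
    change T x = e₀ Φ at hx
    rw [← hx, hU] at hU0
    rw [hU0, map_zero] at hx
    exact e₀_ne_zero Φ hx.symm
  · refine h ⟨_, isClosed_range_of_leftInverse hU,
      not_finiteDimensional_range_of_leftInverse hU, ?_⟩
    refine Function.LeftInverse.isEmbedding
      (f := fun x => ⟨T (S x), ⟨S x, rfl⟩⟩) ?_
      (Continuous.subtype_mk (T.continuous.comp S.continuous) _)
      ((quotientMap Φ).continuous.comp continuous_subtype_val)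
    rintro ⟨_, x, rfl⟩
    exact Subtype.ext (congrArg T (hU x))
  · exact not_isTopologicallyMinimal_of_leftInverse hU h
  · exact h5 h
  · exact not_isCompactOperator_of_leftInverse hU (h T)
  · refine not_scalarPlusCompact_of_leftInverse hU (V := S'.comp (quotientMap Φ)) (fun n => ?_)
      (h (T.comp (S'.comp (quotientMap Φ))))
    rw [ContinuousLinearMap.comp_apply, hunit, hS']

end TwistedSum

/-! ### Block sequences from a topology with trivial dual. -/

/-- Peel off the first term: it lies in `V (k + 1)`, and so does the remaining sum by induction,
whence the general `k`. -/
theorem sum_range_mem_of_balanced {Z : Type*} [AddCommGroup Z] [Module ℝ Z]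
    {V : ℕ → Set Z} (h0 : ∀ k, (0 : Z) ∈ V k)
    (hb : ∀ k, Balanced ℝ (V k)) (hadd : ∀ k, ∀ x ∈ V (k + 1), ∀ y ∈ V (k + 1), x + y ∈ V k)
    {y : ℕ → Z} (hy : ∀ k, y k ∈ V (k + 1)) {c : ℕ → ℝ} (hc : ∀ k, |c k| ≤ 1) (m k : ℕ) :
    ∑ i ∈ Finset.range m, c (k + i) • y (k + i) ∈ V k := by
  induction m generalizing k with
  | zero => simpa using h0 k
  | succ m ih =>
    rw [Finset.sum_range_succ']
    refine hadd k _ ?_ _ ((hb _).smul_mem (hc _) (hy _))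
    simpa only [add_assoc, add_comm 1] using ih (k + 1)

namespace PreTwistedSum

variable {Φ : QuasilinearMap} {Z : Type*} [AddCommGroup Z] [Module ℝ Z] [TopologicalSpace Z]
  [IsTopologicalAddGroup Z] [ContinuousSMul ℝ Z]

/-- If `ℝ ⊕ c₀₀` maps densely into a space with trivial dual, then every neighbourhood of `0`
contains images of vectors whose `c₀₀`-component is normalized and supported far out. -/
theorem exists_mem_nhds_of_trivial_dual (hZ : ∀ f : StrongDual ℝ Z, f = 0)
    (j : PreTwistedSum Φ →ₗ[ℝ] Z) (hj : DenseRange j) {U : Set Z} (hU : U ∈ 𝓝 0) (N : ℕ) :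
    ∃ x : PreTwistedSum Φ, j x ∈ U ∧ l1Norm x.2 = 1 ∧ ∀ i < N, x.2 i = 0 := by
  by_contra! hcon
  obtain ⟨V, ⟨hV, hVb⟩, hVU⟩ := (nhds_basis_balanced ℝ Z).mem_iff.1 hU
  simp only [id] at hVU
  let coord : ℕ → PreTwistedSum Φ →ₗ[ℝ] ℝ := fun i =>
    (Finsupp.lapply i : (ℕ →₀ ℝ) →ₗ[ℝ] ℝ) ∘ₗ LinearMap.snd ℝ ℝ (ℕ →₀ ℝ)
  have hcoord : ∀ i x, coord i x = x.2 i := fun _ _ => rfl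
  let A : Submodule ℝ (PreTwistedSum Φ) :=
    { carrier := {x | ∀ i < N, coord i x = 0}
      zero_mem' := fun i _ => map_zero _
      add_mem' := fun hx hy i hi => by rw [map_add, hx i hi, hy i hi, add_zero]
      smul_mem' := fun c x hx i hi => by rw [map_smul, hx i hi, smul_zero] }
  let b : ℕ → PreTwistedSum Φ := fun i => TwistedSum.inr Φ (Finsupp.single i 1)
  have hb : ∀ i k, coord k (b i) = if i = k then 1 else 0 := fun i k => by
    rw [hcoord]; exact Finsupp.single_apply
  let F : Submodule ℝ Z := Submodule.span ℝ ((fun i => j (b i)) '' (Finset.range N : Set ℕ))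
  have : FiniteDimensional ℝ F :=
    FiniteDimensional.span_of_finite ℝ ((Finset.finite_toSet _).image _)
  -- `A` has finite codimension, and the negated claim bounds `coord N` on `A` near `0`: a vector of
  -- `A` in `V` of norm above 1 could be shrunk to norm 1 within the balanced `V`. Triviality of the
  -- dual then forces `coord N = 0` on `A`, which `b N` refutes.
  have hg : coord N ∘ₗ A.subtype = 0 := by
    refine eq_zero_of_bounded_on_nhds_of_trivial_dual hZ (j ∘ₗ A.subtype) F ?_ _ ⟨V, hV, ?_⟩
    · refine Dense.mono ?_ hj
      rintro _ ⟨x, rfl⟩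
      let y := ∑ i ∈ Finset.range N, coord i x • b i
      have hy : x - y ∈ A := fun k hk => by
        simp only [y, map_sub, map_sum, map_smul, hb, smul_eq_mul, mul_ite, mul_one, mul_zero]
        rw [Finset.sum_ite_eq' , if_pos (Finset.mem_range.2 hk), sub_self]
      have hyF : j y ∈ F := by
        simp only [y, map_sum, map_smul]
        exact Submodule.sum_mem _ fun i hi => Submodule.smul_mem _ _
          (Submodule.subset_span ⟨i, hi, rfl⟩)
      have : j x = j (x - y) + j y := by rw [map_sub, sub_add_cancel]
      rw [this]
      exact Submodule.add_mem_sup ⟨⟨x - y, hy⟩, rfl⟩ hyF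
    · rintro ⟨x, hx⟩ hxV
      change |x.2 N| ≤ 1
      refine (abs_apply_le_l1Norm _ _).trans ?_
      by_contra! h1
      have hpos : 0 < l1Norm x.2 := one_pos.trans h1
      obtain ⟨i, hi, hne⟩ := hcon ((l1Norm x.2)⁻¹ • x) (hVU (by
        rw [map_smul]
        refine hVb.smul_mem ?_ hxV
        rw [norm_inv, Real.norm_eq_abs, abs_of_pos hpos]
        exact inv_le_one_of_one_le₀ h1.le)) (by
          change l1Norm ((l1Norm x.2)⁻¹ • x.2) = 1
          rw [l1Norm_smul, abs_of_pos (inv_pos.2 hpos), inv_mul_cancel₀ hpos.ne'])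
      refine hne ?_
      rw [← hcoord, map_smul, hx i hi, smul_zero]
  have h1 := LinearMap.congr_fun hg ⟨b N, fun i hi => by rw [hb, if_neg hi.ne']⟩
  change coord N (b N) = 0 at h1
  rw [hb, if_pos rfl] at h1
  exact one_ne_zero h1

theorem exists_nhds_sequence {O : Set Z} (hO : O ∈ 𝓝 0) :
    ∃ V : ℕ → Set Z, (∀ k, V k ∈ 𝓝 0) ∧ (∀ k, Balanced ℝ (V k)) ∧
      (∀ x ∈ V 0, ∀ y ∈ V 0, x + y ∈ O) ∧
      ∀ k, ∀ x ∈ V (k + 1), ∀ y ∈ V (k + 1), x + y ∈ V k := by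
  have key : ∀ W : {W : Set Z // W ∈ 𝓝 0}, ∃ V : {V : Set Z // V ∈ 𝓝 0},
      Balanced ℝ V.1 ∧ ∀ x ∈ V.1, ∀ y ∈ V.1, x + y ∈ W.1 := by
    rintro ⟨W, hW⟩
    obtain ⟨V, hV, h⟩ := exists_nhds_zero_half hW
    obtain ⟨V', ⟨hV', hb⟩, hsub⟩ := (nhds_basis_balanced ℝ Z).mem_iff.1 hV
    exact ⟨⟨V', hV'⟩, hb, fun x hx y hy => h x (hsub hx) y (hsub hy)⟩
  choose half hbal hadd using key
  refine ⟨fun k => (half^[k + 1] ⟨O, hO⟩).1, fun k => (half^[k + 1] ⟨O, hO⟩).2, fun k => ?_,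
    hadd _, fun k => ?_⟩
  · simp only [Function.iterate_succ_apply']
    exact hbal _
  · simp only [Function.iterate_succ_apply']
    exact hadd _

theorem exists_block_sequence (hZ : ∀ f : StrongDual ℝ Z, f = 0)
    (j : PreTwistedSum Φ →ₗ[ℝ] Z) (hj : DenseRange j) {V : ℕ → Set Z} (hV : ∀ k, V k ∈ 𝓝 0)
    (hanti : Antitone V) :
    ∃ x : ℕ → PreTwistedSum Φ, (∀ n, j (x n) ∈ V n) ∧ IsNormalizedBlock fun n => (x n).2 := by
  -- Each chosen vector carries the index of its neighbourhood. These indices increase strictly, so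
  -- the `n`-th is at least `n` and antitonicity of `V` applies.
  obtain ⟨f, hfP, hfr⟩ := exists_seq_of_forall_finset_exists
    (fun p : ℕ × PreTwistedSum Φ => j p.2 ∈ V p.1 ∧ l1Norm p.2.2 = 1)
    (fun p q => p.1 < q.1 ∧ ∀ i, p.2.2 i ≠ 0 → q.2.2 i = 0) (by
      intro s _
      let k := s.sup Prod.fst + 1
      let N := (s.biUnion fun p => p.2.2.support).sup id + 1
      obtain ⟨x, hxV, hx1, hxN⟩ := exists_mem_nhds_of_trivial_dual hZ j hj (hV k) N
      refine ⟨(k, x), ⟨hxV, hx1⟩, fun p hp => ⟨Nat.lt_succ_of_le (Finset.le_sup hp), ?_⟩⟩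
      intro i hi
      exact hxN i (Nat.lt_succ_of_le (Finset.le_sup (f := id)
        (Finset.mem_biUnion.2 ⟨p, hp, Finsupp.mem_support_iff.2 hi⟩))))
  have hmono : StrictMono fun n => (f n).1 := fun m n h => (hfr m n h).1
  refine ⟨fun n => (f n).2, fun n => hanti (hmono.le_apply (x := n)) (hfP n).1,
    fun n => (hfP n).2, fun m n i hm hn => ?_⟩
  rcases lt_trichotomy m n with h | h | h
  · exact absurd ((hfr m n h).2 i hm) hn
  · exact h
  · exact absurd ((hfr n m h).2 i hn) hm

/-- With `x n` in rapidly shrinking neighbourhoods, `X a = ∑ aₙ xₙ` maps the unit ball of `c₀₀` into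
`V 0`. Were the first coordinate of `X a` far from `Φ` of the second, a multiple of `X a` in `V 0`
would be close to `e₀`, forcing `e₀` into `O`. So on these blocks `Φ` is close to a linear
functional. -/
theorem boundedOnBlock_of_trivial_dual (hZ : ∀ f : StrongDual ℝ Z, f = 0)
    (j : PreTwistedSum Φ →ₗ[ℝ] Z) (hj : DenseRange j)
    (hcont : ∀ U ∈ 𝓝 (0 : Z), ∃ ε > 0, ∀ x, quasinorm Φ x < ε → j x ∈ U)
    {O : Set Z} (hO : O ∈ 𝓝 0) (he : j (mk Φ 1 0) ∉ O) : BoundedOnBlock Φ := by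
  obtain ⟨V, hV, hVb, hV0, hVadd⟩ := exists_nhds_sequence hO
  have hzero : ∀ k, (0 : Z) ∈ V k := fun k => mem_of_mem_nhds (hV k)
  have hanti : Antitone V := antitone_nat_of_succ_le fun k x hx => by
    simpa using hVadd k x hx 0 (hzero _)
  obtain ⟨x, hxV, hxb⟩ := exists_block_sequence hZ j hj (V := fun k => V (k + 1))
    (fun k => hV _) (fun m n h => hanti (Nat.add_le_add_right h 1))
  let X : (ℕ →₀ ℝ) →ₗ[ℝ] PreTwistedSum Φ := Finsupp.linearCombination ℝ x
  have hX2 : ∀ a, (X a).2 = Finsupp.linearCombination ℝ (fun n => (x n).2) a := fun a => by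
    have : LinearMap.snd ℝ ℝ (ℕ →₀ ℝ) (X a) =
        Finsupp.linearCombination ℝ (fun n => LinearMap.snd ℝ ℝ (ℕ →₀ ℝ) (x n)) a := by
      simp only [X, Finsupp.linearCombination_apply, Finsupp.sum]
      exact (map_sum (LinearMap.snd ℝ ℝ (ℕ →₀ ℝ)) _ _)
    exact this
  have hXV : ∀ a, l1Norm a ≤ 1 → j (X a) ∈ V 0 := by
    intro a ha
    have h1 := sum_range_mem_of_balanced hzero hVb hVadd hxV
      (c := a) (fun k => (abs_apply_le_l1Norm a k).trans ha) (a.support.sup id + 1) 0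
    simp only [zero_add] at h1
    have h2 : j (X a) = ∑ i ∈ Finset.range (a.support.sup id + 1), a i • j (x i) := by
      simp only [X, Finsupp.linearCombination_apply]
      rw [Finsupp.sum_of_support_subset a (Finset.subset_range_sup_succ _) (fun i c => c • x i)
        (fun _ _ => zero_smul _ _), map_sum]
      simp only [map_smul]
    rwa [h2]
  obtain ⟨ε, hε, hεV⟩ := hcont _ (hV 0)
  -- After division by `t`, the 1 puts `X (t⁻¹ • a)` in `V 0`, and `ε⁻¹` makes its difference from
  -- `e₀` have quasinorm below `ε`.
  have hK : 0 < max 1 ε⁻¹ := lt_max_of_lt_left one_pos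
  refine boundedOnBlock_of_linear Φ hxb (LinearMap.fst ℝ ℝ (ℕ →₀ ℝ) ∘ₗ X)
    (K := max 1 ε⁻¹) fun a => ?_
  change |(X a).1 - _| ≤ _
  rw [← hX2]
  by_contra! hlt
  set t := (X a).1 - Φ (X a).2 with ht
  have hapos := l1Norm_nonneg a
  have htpos : 0 < |t| := (mul_nonneg hK.le hapos).trans_lt hlt
  have htne : t ≠ 0 := abs_pos.1 htpos
  have hb : l1Norm (t⁻¹ • a) < (max 1 ε⁻¹)⁻¹ := by
    rw [l1Norm_smul, abs_inv, ← div_eq_inv_mul, div_lt_iff₀ htpos, ← div_eq_inv_mul,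
      lt_div_iff₀ hK, mul_comm]
    exact hlt
  have hb1 : l1Norm (t⁻¹ • a) < 1 := hb.trans_le (inv_le_one_of_one_le₀ (le_max_left _ _))
  have hbε : l1Norm (t⁻¹ • a) < ε := hb.trans_le
    (inv_le_of_inv_le₀ hε (le_max_right _ _))
  have h1 := hXV _ hb1.le
  have h2 : j (X (t⁻¹ • a) - mk Φ 1 0) ∈ V 0 := by
    refine hεV _ ?_
    change |(X (t⁻¹ • a)).1 - 1 - Φ ((X (t⁻¹ • a)).2 - 0)| +
      l1Norm ((X (t⁻¹ • a)).2 - 0) < ε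
    rw [sub_zero]
    -- Dividing by `t` normalizes the defect to exactly 1, which subtracting `e₀` cancels.
    have h3 : (X (t⁻¹ • a)).1 - 1 - Φ (X (t⁻¹ • a)).2 = 0 := by
      rw [map_smul]
      change t⁻¹ * (X a).1 - 1 - Φ (t⁻¹ • (X a).2) = 0
      rw [Φ.map_smul, sub_right_comm, ← mul_sub, ← ht, inv_mul_cancel₀ htne, sub_self]
    rw [h3, abs_zero, zero_add, hX2, hxb.l1Norm_linearCombination]
    exact hbε
  have h4 := hV0 _ h1 _ ((hVb 0).smul_mem (a := -1) (by simp) h2)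
  apply he
  rw [map_sub] at h4
  simpa using h4

end PreTwistedSum

/-! ### The two topologies and the conclusion. -/

theorem NearlyConvex.exists_map_ne_zero {E : Type*} [AddCommGroup E] [Module ℝ E]
    [TopologicalSpace E] {h : IsVectorTopology E inferInstance}
    (hnc : NearlyConvex E inferInstance h) {e : E} (he : ¬ Inseparable e 0) :
    ∃ f : E →ₗ[ℝ] ℝ, Continuous f ∧ f e ≠ 0 := by
  have := h.isTopologicalAddGroup
  have := h.continuousSMul
  have hsd : SeparatingDual ℝ (SeparationQuotient E) := hnc
  obtain ⟨f, hf⟩ := hsd.exists_ne_zero' (SeparationQuotient.mk e) fun h =>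
    he (SeparationQuotient.mk_eq_mk.1 h)
  let g : StrongDual ℝ E := f.comp (SeparationQuotient.mkCLM ℝ E)
  exact ⟨g, g.continuous, hf⟩

/-- Every `τ₁`-neighbourhood of `0` contains `e`, so the separation of `e` from `0` in `τ` must come
from `τ₂`. -/
theorem exists_nhds_notMem_of_inseparable {E : Type*} [Zero E] {τ τ₁ τ₂ : TopologicalSpace E}
    (hτ : τ = τ₁ ⊓ τ₂) (hT1 : @T1Space E τ) {e : E} (he : e ≠ 0)
    (hsep : @Inseparable E τ₁ e 0) : ∃ O ∈ @nhds E τ₂ 0, e ∉ O := by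
  by_contra! hcon
  have hmem : ({e}ᶜ : Set E) ∈ @nhds E τ 0 :=
    @IsOpen.mem_nhds E τ _ _ (@isOpen_compl_singleton E τ hT1 e) he.symm
  rw [hτ, @nhds_inf E τ₁ τ₂ 0, mem_inf_iff] at hmem
  obtain ⟨O₁, hO₁, O₂, hO₂, h⟩ := hmem
  rw [← @Inseparable.nhds_eq E τ₁ _ _ hsep] at hO₁
  have : e ∈ O₁ ∩ O₂ := ⟨@mem_of_mem_nhds E τ₁ _ _ hO₁, hcon O₂ hO₂⟩
  rw [← h] at this
  exact this rfl

/-- The supremum of two topologies in the usual sense (the coarsest topology finer than both) is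
`τ₁ ⊓ τ₂` in Mathlib's order. The hypothesis asks for any single one of the seven conditions. -/
theorem theorem2p3 (Φ : QuasilinearMap)
    (hΦ : TwistedSum.NoBasicSequence Φ ∨
      TwistedSum.ClosedSubspacesContain Φ ∨
      IsStrictlySingular (TwistedSum.quotientMap Φ) ∨
      IsTopologicallyMinimal (TwistedSum Φ) (TwistedSum.topology Φ) ∨
      TwistedSum.NowhereBounded Φ ∨
      TwistedSum.OperatorsFromEllOneCompact Φ ∨
      TwistedSum.OperatorsScalarPlusCompact Φ) :
    ¬ ∃ (τ₁ τ₂ : TopologicalSpace (TwistedSum Φ))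
        (h₁ : IsVectorTopology (TwistedSum Φ) τ₁) (_h₂ : IsVectorTopology (TwistedSum Φ) τ₂),
      TwistedSum.topology Φ = τ₁ ⊓ τ₂ ∧
        NearlyConvex (TwistedSum Φ) τ₁ h₁ ∧ HasTrivialDual (TwistedSum Φ) τ₂ := by
  have hcond : @ContinuousSMul ℝ (TwistedSum Φ) _ _ (TwistedSum.topology Φ) → ¬ BoundedOnBlock Φ :=
    fun h hb => @TwistedSum.not_condition_of_boundedOnBlock Φ h hb hΦ
  have hT1 : T1Space (TwistedSum Φ) := inferInstance
  have hdense := TwistedSum.denseRange_coeLin Φ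
  have hsplit : ∀ f : TwistedSum Φ →ₗ[ℝ] ℝ, Continuous f → f (TwistedSum.e₀ Φ) ≠ 0 →
      BoundedOnBlock Φ :=
    fun f hf => TwistedSum.boundedOnBlock_of_map_e₀_ne_zero Φ ⟨f, hf⟩
  rintro ⟨τ₁, τ₂, h₁, h₂, hτ, hnc, htd⟩
  -- Joint continuity of scalar multiplication for `τ` is inherited from `τ₁` and `τ₂`.
  have hb := hcond (hτ ▸ @continuousSMul_inf _ _ _ _ τ₁ τ₂ h₁.continuousSMul h₂.continuousSMul)
  have hle₁ : TwistedSum.topology Φ ≤ τ₁ := hτ ▸ inf_le_left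
  have hle₂ : TwistedSum.topology Φ ≤ τ₂ := hτ ▸ inf_le_right
  obtain ⟨O, hO, heO⟩ := exists_nhds_notMem_of_inseparable hτ hT1 (TwistedSum.e₀_ne_zero Φ) (by
    by_contra hne
    obtain ⟨f, hfc, hfe⟩ := @NearlyConvex.exists_map_ne_zero _ _ _ τ₁ h₁ hnc _ hne
    exact hb (hsplit f (continuous_le_dom hle₁ hfc) hfe))
  exact hb <| @PreTwistedSum.boundedOnBlock_of_trivial_dual Φ (TwistedSum Φ) _ _ τ₂
    h₂.isTopologicalAddGroup h₂.continuousSMul htd (TwistedSum.coeLin Φ)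
    (fun y => closure.mono hle₂ (hdense y))
    (fun U hU => TwistedSum.exists_quasinorm_lt_of_mem_nhds Φ (nhds_mono hle₂ hU)) O hO heO
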